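/- A real function $f$ on an interval $I\subseteq\mathbb R$ is called $n$-monotone on $I$ if $f(A)\le f(B)$ for all self-adjoint complex $n\times n$ matrices $A\le B$ whose eigenvalues lie in $I$, and $n$-convex on $I$ if $f(\lambda A+(1-\lambda)B)\le \lambda f(A)+(1-\lambda)f(B)$ for all self-adjoint complex $n\times n$ matrices $A,B$ whose eigenvalues lie in $I$ and all $\lambda\in[0,1]$; here $f(A)$ is defined by the functional calculus and $\le$ is the Loewner order. Theorem. For every $\alpha>0$ there is a $2$-monotone function $g$ on $(0,\alpha)$ such that the function $f(t)=t\,g(t)$ (with $f(0)=0$) is not $2$-convex on $[0,\alpha)$. More precisely, there are a real polynomial $P$ of degree $5$ and a number $\beta>0$, both independent of $\alpha$, such that for every $\alpha>0$ one can choose $g$ with $t\,g(t)=P(\beta t/\alpha)$ for all $t\in[0,\alpha)$ (so that in particular $P(0)=0$). -/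

import Mathlib

open scoped ComplexOrder

/-- `f` is matrix monotone of order `n` (`n`-monotone) on `I`: for all self-adjoint complex
`n × n` matrices `A ≤ B` (Loewner order) with all eigenvalues in `I`, one has `f(A) ≤ f(B)`,
where `f(A)` is given by the functional calculus. -/
def IsMatrixMonotoneOn (n : ℕ) (I : Set ℝ) (f : ℝ → ℝ) : Prop :=
  ∀ A B : Matrix (Fin n) (Fin n) ℂ, A.IsHermitian → B.IsHermitian →
    spectrum ℝ A ⊆ I → spectrum ℝ B ⊆ I →
    (B - A).PosSemidef → (cfc f B - cfc f A).PosSemidef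

/-- `f` is matrix convex of order `n` (`n`-convex) on `I`: for all self-adjoint complex
`n × n` matrices `A`, `B` with all eigenvalues in `I` and all `c ∈ [0, 1]`, one has
`f(c A + (1 - c) B) ≤ c f(A) + (1 - c) f(B)` in the Loewner order. -/
def IsMatrixConvexOn (n : ℕ) (I : Set ℝ) (f : ℝ → ℝ) : Prop :=
  ∀ A B : Matrix (Fin n) (Fin n) ℂ, A.IsHermitian → B.IsHermitian →
    spectrum ℝ A ⊆ I → spectrum ℝ B ⊆ I →
    ∀ c : ℝ, c ∈ Set.Icc (0 : ℝ) 1 →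
      (c • cfc f A + (1 - c) • cfc f B - cfc f (c • A + (1 - c) • B)).PosSemidef

/-! Take `P = X ^ 2 + X ^ 4 + X ^ 5` and `β = 3 / 8`; rescaling by `k = β / α` reduces everything to
`h x = x + x ^ 3 + x ^ 4` and `x * h x = P x` on `[0, 3/8]`. Monotonicity is Loewner's argument: in
an eigenbasis of `A`, the derivative of `h` at `A` is the Hadamard product with the matrix of
divided differences of `h`. For two points in `[0, 3/8]` that matrix is positive semidefinite
(`quarticSlope_sq_le`), so Schur's product theorem and monotonicity along the segment from `A` to
`B` give the claim. Convexity of `P` is the stronger demand: with Taylor coefficients `cᵢ` at a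
point, order 2 monotonicity locally asks for `c₁ c₃ ≥ c₂ ^ 2`, order 2 convexity for `c₂ c₄ ≥ c₃ ^
2`. At `3/8` the first holds for `h` while the second already fails for `P`. An explicit pair of
matrices with spectrum in `[0, 7/19]`, where `7/19 < 3/8`, makes the failure concrete. -/

lemma binary_quadratic_nonneg {a b d : ℝ} (ha : 0 ≤ a) (hd : 0 ≤ d) (h : b ^ 2 ≤ a * d)
    (x y : ℝ) : 0 ≤ a * x ^ 2 + 2 * b * x * y + d * y ^ 2 := by
  rcases ha.eq_or_lt with rfl | ha
  · have hb : b = 0 := by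
      have : b ^ 2 ≤ 0 := by simpa using h
      exact pow_eq_zero_iff two_ne_zero |>.1 (le_antisymm this (sq_nonneg b))
    subst hb
    nlinarith [mul_nonneg hd (sq_nonneg y)]
  · refine nonneg_of_mul_nonneg_right (a := a) ?_ ha
    nlinarith [sq_nonneg (a * x + b * y), mul_nonneg (sub_nonneg.2 h) (sq_nonneg y)]

lemma Matrix.posSemidef_fin_two_of_real {a b d : ℝ} (ha : 0 ≤ a) (hd : 0 ≤ d)
    (h : b ^ 2 ≤ a * d) : (!![(a : ℂ), b; b, d]).PosSemidef := by
  refine Matrix.PosSemidef.of_dotProduct_mulVec_nonneg ?_ fun v => ?_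
  · ext i j
    fin_cases i <;> fin_cases j <;> simp
  · have h1 := binary_quadratic_nonneg ha hd h (v 0).re (v 1).re
    have h2 := binary_quadratic_nonneg ha hd h (v 0).im (v 1).im
    rw [Complex.nonneg_iff]
    constructor
    · simp [Matrix.mulVec, dotProduct, Fin.sum_univ_two]
      nlinarith
    · simp [Matrix.mulVec, dotProduct, Fin.sum_univ_two]
      ring

lemma Matrix.IsHermitian.posSemidef_iff_spectrum_real_nonneg {n : Type*} [Fintype n]
    [DecidableEq n] {A : Matrix n n ℂ} (hA : A.IsHermitian) :
    A.PosSemidef ↔ ∀ x ∈ spectrum ℝ A, 0 ≤ x := by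
  rw [hA.posSemidef_iff_eigenvalues_nonneg, hA.spectrum_real_eq_range_eigenvalues,
    Set.forall_mem_range]
  rfl

/-- Two Loewner inequalities are stable under convex combinations, so this form keeps whole segments
inside the spectral interval. -/
lemma Matrix.IsHermitian.spectrum_subset_Icc_iff {n : Type*} [Fintype n] [DecidableEq n]
    {A : Matrix n n ℂ} (hA : A.IsHermitian) (r : ℝ) :
    spectrum ℝ A ⊆ Set.Icc 0 r ↔
      A.PosSemidef ∧ (algebraMap ℝ (Matrix n n ℂ) r - A).PosSemidef := by
  have hr : (algebraMap ℝ (Matrix n n ℂ) r - A).IsHermitian := by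
    have : IsSelfAdjoint (algebraMap ℝ (Matrix n n ℂ) r) :=
      (IsSelfAdjoint.all r).algebraMap _
    exact Matrix.IsHermitian.sub this hA
  rw [hA.posSemidef_iff_spectrum_real_nonneg, hr.posSemidef_iff_spectrum_real_nonneg,
    ← spectrum.singleton_sub_eq]
  simp [Set.subset_def, forall_and]

/-- The first divided difference of `t + t ^ 3 + t ^ 4`. -/
def quarticSlope (x y : ℝ) : ℝ :=
  1 + (x ^ 2 + x * y + y ^ 2) + (x ^ 3 + x ^ 2 * y + x * y ^ 2 + y ^ 3)

lemma quarticSlope_sq_le {x y : ℝ} (hx : x ∈ Set.Icc (0 : ℝ) (3 / 8))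
    (hy : y ∈ Set.Icc (0 : ℝ) (3 / 8)) :
    quarticSlope x y ^ 2 ≤ quarticSlope x x * quarticSlope y y := by
  obtain ⟨hx0, hx1⟩ := hx
  obtain ⟨hy0, hy1⟩ := hy
  -- This is the cofactor of `(x - y) ^ 2` in the Loewner determinant. Each symmetric form is
  -- bounded by a power of `x + y`, with equality at `x = y`.
  have hR : 0 ≤ 1 + 2 * (x + y) - (x ^ 2 + 4 * x * y + y ^ 2)
      - 2 * (x + y) * (x ^ 2 + 3 * x * y + y ^ 2)
      - (x ^ 4 + 4 * x ^ 3 * y + 10 * x ^ 2 * y ^ 2 + 4 * x * y ^ 3 + y ^ 4) := by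
    have hs0 : 0 ≤ x + y := by linarith
    have hs : x + y ≤ 3 / 4 := by linarith
    have hxy : 0 ≤ x * y := mul_nonneg hx0 hy0
    have h4 : 4 * (x * y) ≤ (x + y) ^ 2 := by nlinarith [sq_nonneg (x - y)]
    have hs2 : (x + y) ^ 2 ≤ 9 / 16 := by nlinarith
    have e2 : x ^ 2 + 4 * x * y + y ^ 2 ≤ 3 / 2 * (x + y) ^ 2 := by nlinarith
    have e3 : x ^ 2 + 3 * x * y + y ^ 2 ≤ 5 / 4 * (x + y) ^ 2 := by nlinarith
    have e4 : x ^ 4 + 4 * x ^ 3 * y + 10 * x ^ 2 * y ^ 2 + 4 * x * y ^ 3 + y ^ 4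
        ≤ 5 / 4 * ((x + y) ^ 2) ^ 2 := by
      have : (x * y) * (x * y) ≤ ((x + y) ^ 2 / 4) * ((x + y) ^ 2 / 4) :=
        mul_le_mul (by linarith) (by linarith) hxy (by positivity)
      nlinarith
    have e3' : (x + y) * (x ^ 2 + 3 * x * y + y ^ 2) ≤ (x + y) * (45 / 64) :=
      mul_le_mul_of_nonneg_left (by linarith) hs0
    nlinarith
  have : quarticSlope x x * quarticSlope y y - quarticSlope x y ^ 2 =
      (x - y) ^ 2 * (1 + 2 * (x + y) - (x ^ 2 + 4 * x * y + y ^ 2)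
      - 2 * (x + y) * (x ^ 2 + 3 * x * y + y ^ 2)
      - (x ^ 4 + 4 * x ^ 3 * y + 10 * x ^ 2 * y ^ 2 + 4 * x * y ^ 3 + y ^ 4)) := by
    unfold quarticSlope; ring
  nlinarith [mul_nonneg (sq_nonneg (x - y)) hR]

lemma quarticSlope_comm (x y : ℝ) : quarticSlope x y = quarticSlope y x := by
  unfold quarticSlope; ring

lemma quarticSlope_nonneg {x y : ℝ} (hx : 0 ≤ x) (hy : 0 ≤ y) : 0 ≤ quarticSlope x y := by
  unfold quarticSlope; positivity

lemma posSemidef_quarticSlope {d : Fin 2 → ℝ} (hd : ∀ i, d i ∈ Set.Icc (0 : ℝ) (3 / 8)) :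
    (Matrix.of fun i j => (quarticSlope (d i) (d j) : ℂ)).PosSemidef := by
  convert Matrix.posSemidef_fin_two_of_real (quarticSlope_nonneg (hd 0).1 (hd 0).1)
    (quarticSlope_nonneg (hd 1).1 (hd 1).1) (quarticSlope_sq_le (hd 0) (hd 1)) using 1
  ext i j
  fin_cases i <;> fin_cases j <;> simp [quarticSlope_comm (d 1) (d 0)]

/-- The directional derivative of `A + A ^ 3 + A ^ 4` in direction `H`. -/
def quarticDeriv {R : Type*} [Ring R] (A H : R) : R :=
  H + (H * A * A + A * H * A + A * A * H) +
    (H * A * A * A + A * H * A * A + A * A * H * A + A * A * A * H)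

lemma quarticDeriv_diagonal {n : Type*} [Fintype n] [DecidableEq n] (d : n → ℝ)
    (K : Matrix n n ℂ) :
    quarticDeriv (Matrix.diagonal fun i => (d i : ℂ)) K =
      Matrix.hadamard (Matrix.of fun i j => (quarticSlope (d i) (d j) : ℂ)) K := by
  ext i j
  simp only [quarticDeriv, Matrix.add_apply, Matrix.mul_diagonal, Matrix.diagonal_mul,
    Matrix.diagonal_mul_diagonal, Matrix.hadamard_apply, Matrix.of_apply, quarticSlope]
  push_cast
  ring

lemma map_quarticDeriv {R S F : Type*} [Ring R] [Ring S] [FunLike F R S] [RingHomClass F R S]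
    (φ : F) (A H : R) : φ (quarticDeriv A H) = quarticDeriv (φ A) (φ H) := by
  simp [quarticDeriv]

/-- Conjugation to an eigenbasis of `A` turns the derivative into a Hadamard product of two positive
semidefinite matrices. -/
lemma posSemidef_quarticDeriv {A H : Matrix (Fin 2) (Fin 2) ℂ} (hA : A.IsHermitian)
    (hs : spectrum ℝ A ⊆ Set.Icc 0 (3 / 8)) (hH : H.PosSemidef) :
    (quarticDeriv A H).PosSemidef := by
  set U := hA.eigenvectorUnitary
  set φ := Unitary.conjStarAlgAut ℂ (Matrix (Fin 2) (Fin 2) ℂ) U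
  have hd : ∀ i, hA.eigenvalues i ∈ Set.Icc (0 : ℝ) (3 / 8) := fun i => hs (by
    rw [hA.spectrum_real_eq_range_eigenvalues]; exact ⟨i, rfl⟩)
  have hK : (φ.symm H).PosSemidef := by
    have := hH.conjTranspose_mul_mul_same (U : Matrix (Fin 2) (Fin 2) ℂ)
    simpa [φ, Unitary.conjStarAlgAut_symm_apply, Matrix.star_eq_conjTranspose] using this
  have h1 := (posSemidef_quarticSlope hd).hadamard hK
  rw [← quarticDeriv_diagonal] at h1
  have h2 : quarticDeriv A H = φ (quarticDeriv
      (Matrix.diagonal fun i => (hA.eigenvalues i : ℂ)) (φ.symm H)) := by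
    rw [map_quarticDeriv, StarAlgEquiv.apply_symm_apply]
    congr 1
    exact hA.spectral_theorem
  rw [h2, Unitary.conjStarAlgAut_apply]
  exact h1.mul_mul_conjTranspose_same _

lemma hasDerivAt_quartic_line {R : Type*} [NormedRing R] [NormedAlgebra ℝ R] (A H : R) (s : ℝ) :
    HasDerivAt (fun s : ℝ => (A + s • H) + (A + s • H) ^ 3 + (A + s • H) ^ 4)
      (quarticDeriv (A + s • H) H) s := by
  have h : HasDerivAt (fun s : ℝ => A + s • H) H s := by
    have := ((hasDerivAt_id s).smul_const H).const_add A
    rwa [one_smul] at this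
  have h2 := h.mul h
  have h3 := h2.mul h
  have h4 := h3.mul h
  refine (((h.add h3).add h4).congr_deriv ?_).congr_of_eventuallyEq (.of_forall fun s => ?_)
  · simp only [quarticDeriv, Pi.mul_apply]
    generalize A + s • H = M
    noncomm_ring
  · simp [pow_succ]

section

open scoped Matrix.Norms.Operator

lemma hasDerivAt_quadraticForm_quartic_line {n : Type*} [Fintype n] [DecidableEq n]
    (A H : Matrix n n ℂ) (v : n → ℂ) (s : ℝ) :
    HasDerivAt (fun s : ℝ => (star v ⬝ᵥ
        ((A + s • H) + (A + s • H) ^ 3 + (A + s • H) ^ 4).mulVec v).re)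
      (star v ⬝ᵥ (quarticDeriv (A + s • H) H).mulVec v).re s := by
  let ℓ : Matrix n n ℂ →ₗ[ℝ] ℝ :=
    { toFun := fun M => (star v ⬝ᵥ M.mulVec v).re
      map_add' := fun M N => by simp [Matrix.add_mulVec, dotProduct_add]
      map_smul' := fun c M => by simp [Matrix.smul_mulVec, dotProduct_smul] }
  exact (LinearMap.toContinuousLinearMap ℓ).hasFDerivAt.comp_hasDerivAt s
    (hasDerivAt_quartic_line A H s)

end

/-- For each fixed vector, the quadratic form along the segment has nonnegative derivative, hence is
monotone on `[0, 1]`. -/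
lemma posSemidef_quartic_sub {A B : Matrix (Fin 2) (Fin 2) ℂ} (hA : A.IsHermitian)
    (hB : B.IsHermitian) (hsA : spectrum ℝ A ⊆ Set.Icc 0 (3 / 8))
    (hsB : spectrum ℝ B ⊆ Set.Icc 0 (3 / 8)) (hAB : (B - A).PosSemidef) :
    ((B + B ^ 3 + B ^ 4) - (A + A ^ 3 + A ^ 4)).PosSemidef := by
  have hline : ∀ s ∈ Set.Icc (0 : ℝ) 1, (quarticDeriv (A + s • (B - A)) (B - A)).PosSemidef := by
    intro s hs
    have e : A + s • (B - A) = (1 - s) • A + s • B := by module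
    have h0 : 0 ≤ 1 - s := by linarith [hs.2]
    rw [hA.spectrum_subset_Icc_iff] at hsA
    rw [hB.spectrum_subset_Icc_iff] at hsB
    have hP : (A + s • (B - A)).PosSemidef := by
      rw [e]; exact (hsA.1.smul h0).add (hsB.1.smul hs.1)
    refine posSemidef_quarticDeriv hP.isHermitian
      ((hP.isHermitian.spectrum_subset_Icc_iff _).2 ⟨hP, ?_⟩) hAB
    convert (hsA.2.smul h0).add (hsB.2.smul hs.1) using 1
    rw [e]
    module
  have hherm : ∀ M : Matrix (Fin 2) (Fin 2) ℂ, M.IsHermitian →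
      (M + M ^ 3 + M ^ 4).IsHermitian := fun M hM => (hM.add (hM.pow 3)).add (hM.pow 4)
  have hsub := (hherm B hB).sub (hherm A hA)
  refine Matrix.PosSemidef.of_dotProduct_mulVec_nonneg hsub fun v => ?_
  have hderiv := hasDerivAt_quadraticForm_quartic_line A (B - A) v
  have hmono := monotoneOn_of_deriv_nonneg (convex_Icc (0 : ℝ) 1)
    (fun s _ => (hderiv s).continuousAt.continuousWithinAt)
    (fun s _ => (hderiv s).differentiableAt.differentiableWithinAt)
    (fun s hs => by
      rw [(hderiv s).deriv]
      exact (Complex.nonneg_iff.1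
        ((hline s (interior_subset hs)).dotProduct_mulVec_nonneg v)).1)
  have := hmono (Set.left_mem_Icc.2 zero_le_one) (Set.right_mem_Icc.2 zero_le_one) zero_le_one
  simp only [zero_smul, add_zero, one_smul, add_sub_cancel] at this
  rw [Complex.nonneg_iff]
  refine ⟨?_, ?_⟩
  · rw [Matrix.sub_mulVec, dotProduct_sub, Complex.sub_re]
    linarith
  · exact (hsub.im_star_dotProduct_mulVec_self v).symm

lemma cfc_quintic_comp_smul {n : Type*} [Fintype n] [DecidableEq n] {A : Matrix n n ℂ}
    (hA : A.IsHermitian) (k : ℝ) :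
    cfc (fun t : ℝ => (k * t) ^ 2 + (k * t) ^ 4 + (k * t) ^ 5) A =
      (k • A) ^ 2 + (k • A) ^ 4 + (k • A) ^ 5 := by
  have := cfc_polynomial (((Polynomial.C k * Polynomial.X) ^ 2 +
    (Polynomial.C k * Polynomial.X) ^ 4 + (Polynomial.C k * Polynomial.X) ^ 5 : Polynomial ℝ)) A hA
  simpa [Algebra.smul_def] using this

lemma cfc_quartic_comp_smul {n : Type*} [Fintype n] [DecidableEq n] {A : Matrix n n ℂ}
    (hA : A.IsHermitian) (k : ℝ) :
    cfc (fun t : ℝ => k * (k * t + (k * t) ^ 3 + (k * t) ^ 4)) A =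
      k • (k • A + (k • A) ^ 3 + (k • A) ^ 4) := by
  have := cfc_polynomial ((Polynomial.C k * (Polynomial.C k * Polynomial.X +
    (Polynomial.C k * Polynomial.X) ^ 3 + (Polynomial.C k * Polynomial.X) ^ 4) : Polynomial ℝ)) A hA
  simpa [Algebra.smul_def] using this

lemma Matrix.IsHermitian.spectrum_smul_subset_Icc_iff {n : Type*} [Fintype n] [DecidableEq n]
    {A : Matrix n n ℂ} (hA : A.IsHermitian) {k : ℝ} (hk : 0 < k) (r : ℝ) :
    spectrum ℝ (k • A) ⊆ Set.Icc 0 (k * r) ↔ spectrum ℝ A ⊆ Set.Icc 0 r := by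
  have hkA : (k • A).IsHermitian := hA.smul (IsSelfAdjoint.all k)
  have hiff : ∀ M : Matrix n n ℂ, (k • M).PosSemidef ↔ M.PosSemidef := fun M =>
    ⟨fun h => by simpa [smul_smul, hk.ne'] using h.smul (inv_pos.2 hk).le, fun h => h.smul hk.le⟩
  rw [hA.spectrum_subset_Icc_iff, hkA.spectrum_subset_Icc_iff, hiff, ← hiff (_ - A), smul_sub,
    Algebra.algebraMap_eq_smul_one, Algebra.algebraMap_eq_smul_one, smul_smul]

lemma isMatrixMonotoneOn_quartic {α k : ℝ} (hk : 0 < k) (hα : k * α = 3 / 8) :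
    IsMatrixMonotoneOn 2 (Set.Ioo 0 α)
      (fun t => k * (k * t + (k * t) ^ 3 + (k * t) ^ 4)) := by
  intro A B hA hB hsA hsB hAB
  rw [cfc_quartic_comp_smul hA, cfc_quartic_comp_smul hB, ← smul_sub]
  refine (posSemidef_quartic_sub (hA.smul (IsSelfAdjoint.all k))
    (hB.smul (IsSelfAdjoint.all k)) ?_ ?_ ?_).smul hk.le
  · rw [← hα, hA.spectrum_smul_subset_Icc_iff hk]
    exact hsA.trans Set.Ioo_subset_Icc_self
  · rw [← hα, hB.spectrum_smul_subset_Icc_iff hk]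
    exact hsB.trans Set.Ioo_subset_Icc_self
  · rw [← smul_sub]
    exact hAB.smul hk.le

lemma spectrum_subset_Icc_of_fin_two {a b d r : ℝ} (ha : 0 ≤ a) (hd : 0 ≤ d)
    (h : b ^ 2 ≤ a * d) (har : a ≤ r) (hdr : d ≤ r) (hr : b ^ 2 ≤ (r - a) * (r - d)) :
    spectrum ℝ (!![(a : ℂ), b; b, d]) ⊆ Set.Icc 0 r := by
  have hP := Matrix.posSemidef_fin_two_of_real ha hd h
  refine (hP.isHermitian.spectrum_subset_Icc_iff r).2 ⟨hP, ?_⟩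
  convert Matrix.posSemidef_fin_two_of_real (a := r - a) (b := -b) (d := r - d)
    (by linarith) (by linarith) (by linarith [neg_sq b]) using 1
  ext i j
  fin_cases i <;> fin_cases j <;> simp [Matrix.algebraMap_matrix_apply]

lemma not_isMatrixConvexOn_quintic {α k : ℝ} (hk : 0 < k) (hα : 7 / 19 < k * α) :
    ¬ IsMatrixConvexOn 2 (Set.Ico 0 α)
      (fun t => (k * t) ^ 2 + (k * t) ^ 4 + (k * t) ^ 5) := by
  intro hconv
  -- Here `B - A` has rank one. The midpoint convexity defect of this pair has negative determinant,
  -- so it is not positive semidefinite.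
  set A : Matrix (Fin 2) (Fin 2) ℂ := !![((5 / 19 : ℝ) : ℂ), ((-1 / 19 : ℝ) : ℂ);
    ((-1 / 19 : ℝ) : ℂ), ((6 / 19 : ℝ) : ℂ)] with hAdef
  set B : Matrix (Fin 2) (Fin 2) ℂ := !![((6 / 19 : ℝ) : ℂ), ((0 : ℝ) : ℂ);
    ((0 : ℝ) : ℂ), ((7 / 19 : ℝ) : ℂ)] with hBdef
  have hA : A.IsHermitian := (Matrix.posSemidef_fin_two_of_real
    (by norm_num) (by norm_num) (by norm_num)).isHermitian
  have hB : B.IsHermitian := (Matrix.posSemidef_fin_two_of_real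
    (by norm_num) (by norm_num) (by norm_num)).isHermitian
  have hsA : spectrum ℝ A ⊆ Set.Icc 0 (7 / 19) := spectrum_subset_Icc_of_fin_two
    (by norm_num) (by norm_num) (by norm_num) (by norm_num) (by norm_num) (by norm_num)
  have hsB : spectrum ℝ B ⊆ Set.Icc 0 (7 / 19) := spectrum_subset_Icc_of_fin_two
    (by norm_num) (by norm_num) (by norm_num) (by norm_num) (by norm_num) (by norm_num)
  have hscale : ∀ M : Matrix (Fin 2) (Fin 2) ℂ, M.IsHermitian →
      spectrum ℝ M ⊆ Set.Icc 0 (7 / 19) → spectrum ℝ (k⁻¹ • M) ⊆ Set.Ico 0 α := by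
    intro M hM hs
    refine ((hM.spectrum_smul_subset_Icc_iff (inv_pos.2 hk) _).2 hs).trans fun t ht => ⟨ht.1, ?_⟩
    refine ht.2.trans_lt ?_
    rwa [inv_mul_lt_iff₀ hk]
  have hk' : ∀ M : Matrix (Fin 2) (Fin 2) ℂ, k • k⁻¹ • M = M := fun M =>
    smul_inv_smul₀ hk.ne' M
  have hA' : (k⁻¹ • A).IsHermitian := hA.smul (IsSelfAdjoint.all _)
  have hB' : (k⁻¹ • B).IsHermitian := hB.smul (IsSelfAdjoint.all _)
  have h := hconv (k⁻¹ • A) (k⁻¹ • B) hA' hB' (hscale A hA hsA) (hscale B hB hsB) (1 / 2)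
    ⟨by norm_num, by norm_num⟩
  have hC : k • ((1 / 2 : ℝ) • k⁻¹ • A + (1 - 1 / 2 : ℝ) • k⁻¹ • B) =
      (1 / 2 : ℝ) • A + (1 / 2 : ℝ) • B := by
    rw [smul_add, smul_comm k (1 / 2 : ℝ), smul_comm k (1 - 1 / 2 : ℝ), hk', hk']
    norm_num
  rw [cfc_quintic_comp_smul hA', cfc_quintic_comp_smul hB', cfc_quintic_comp_smul
    ((hA'.smul (IsSelfAdjoint.all _)).add (hB'.smul (IsSelfAdjoint.all _))), hC, hk', hk'] at h
  have hdet := h.det_nonneg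
  have hval : ((1 / 2 : ℝ) • (A ^ 2 + A ^ 4 + A ^ 5) + (1 - 1 / 2 : ℝ) • (B ^ 2 + B ^ 4 + B ^ 5)
      - (((1 / 2 : ℝ) • A + (1 / 2 : ℝ) • B) ^ 2 + ((1 / 2 : ℝ) • A + (1 / 2 : ℝ) • B) ^ 4
        + ((1 / 2 : ℝ) • A + (1 / 2 : ℝ) • B) ^ 5)).det
      = ((-63411 / 196194120249632 : ℝ) : ℂ) := by
    have hAB : (1 / 2 : ℝ) • A + (1 / 2 : ℝ) • B = !![11 / 38, -1 / 38; -1 / 38, 13 / 38] := by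
      ext i j
      fin_cases i <;> fin_cases j <;> simp [hAdef, hBdef] <;> norm_num
    rw [hAB, Matrix.det_fin_two, hAdef, hBdef]
    simp [pow_succ]
    norm_num
  rw [hval, Complex.zero_le_real] at hdet
  norm_num at hdet

theorem mainTheorem6 :
    ∃ (P : Polynomial ℝ) (β : ℝ), P.natDegree = 5 ∧ 0 < β ∧
      ∀ α : ℝ, 0 < α → ∃ g : ℝ → ℝ,
        (∀ t ∈ Set.Ico (0 : ℝ) α, t * g t = P.eval (β / α * t)) ∧
        IsMatrixMonotoneOn 2 (Set.Ioo 0 α) g ∧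
        ¬ IsMatrixConvexOn 2 (Set.Ico 0 α) (fun t => t * g t) := by
  refine ⟨Polynomial.X ^ 2 + Polynomial.X ^ 4 + Polynomial.X ^ 5, 3 / 8, by compute_degree!,
    by norm_num, fun α hα => ?_⟩
  have hk : 0 < 3 / 8 / α := by positivity
  have hkα : 3 / 8 / α * α = 3 / 8 := div_mul_cancel₀ _ hα.ne'
  set k := 3 / 8 / α
  refine ⟨fun t => k * (k * t + (k * t) ^ 3 + (k * t) ^ 4), fun t _ => ?_,
    isMatrixMonotoneOn_quartic hk hkα, ?_⟩
  · simp only [Polynomial.eval_add, Polynomial.eval_pow, Polynomial.eval_X]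
    ring
  · convert not_isMatrixConvexOn_quintic hk (by rw [hkα]; norm_num) using 3
    ring
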